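/- Let $\Gamma\subset\mathbb{R}^2$ be a simple closed convex curve, i.e. the boundary of a compact convex set with non-empty interior $\Omega$, and assume that $\Gamma$ is regular and of class $C^2$: it is the image of a $C^2$ map $\gamma:\mathbb{R}\to\mathbb{R}^2$ that is periodic with some period $\ell>0$, injective on $[0,\ell)$ and satisfies $\gamma'(t)\neq 0$ for all $t$. Let $N$ be the unit normal obtained by rotating $\gamma'/|\gamma'|$ by $+\pi/2$, and let $\kappa=\det(\gamma',\gamma'')/|\gamma'|^3$ be the signed curvature. Assume that all curvature centers of $\Gamma$ lie in $\Omega$, i.e. for all $t$ one has $\kappa(t)\neq 0$ (so that the curvature center at $\gamma(t)$ exists) and $$\gamma(t)+\frac{1}{\kappa(t)}N(t)\in\Omega .$$ Let $L(\Gamma)=\int_0^{\ell}|\gamma'(t)|\,dt$ be the length of $\Gamma$ and let $$\delta(\Gamma)=\inf_{p\in\Gamma}\ \sup_{q\in\Gamma} d(p,q)=\min_{p\in\Gamma}\ \max_{q\in\Gamma} d(p,q),$$ where $d$ is the Euclidean distance. Then $$L(\Gamma)\ \ge\ \pi\,\delta(\Gamma),$$ and equality holds if and only if $\Gamma$ is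 of constant breadth, i.e. the breadth $\max_{x\in\Gamma}\langle u,x\rangle-\min_{x\in\Gamma}\langle u,x\rangle$ is the same for all unit vectors $u\in\mathbb{R}^2$. -/

import Mathlib

noncomputable section

namespace PlaneCurve

/-- The Euclidean plane. -/
abbrev Plane : Type := EuclideanSpace ℝ (Fin 2)

/-- Rotation of the plane by the angle `π / 2`, counterclockwise. -/
def rot (v : Plane) : Plane := !₂[-(v 1), v 0]

/-- `γ` parametrizes the set `Γ` as a simple closed regular curve of class `C²`: it is a `C²` map
on `ℝ`, periodic with period `ℓ > 0`, with nowhere vanishing derivative, injective on `[0, ℓ)`,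
and with image `Γ`. The parameter need not be the arclength, and either orientation is allowed. -/
structure IsClosedRegularC2Param (Γ : Set Plane) (γ : ℝ → Plane) (ℓ : ℝ) : Prop where
  period_pos : 0 < ℓ
  periodic : Function.Periodic γ ℓ
  contDiff : ContDiff ℝ 2 γ
  regular : ∀ t, deriv γ t ≠ 0
  injOn : Set.InjOn γ (Set.Ico 0 ℓ)
  range_eq : Set.range γ = Γ

/-- The convex body `C` belonging to a closed convex curve `Γ`. -/
def body (Γ : Set Plane) : Set Plane := convexHull ℝ Γ

/-- The open region `Ω` enclosed by a closed convex curve `Γ`, i.e. the interior of its body. -/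
def inside (Γ : Set Plane) : Set Plane := interior (body Γ)

/-- `Γ` is a convex curve: it is the boundary of a convex body, which is then the convex hull
of `Γ`, and which has interior points. -/
def IsConvexCurve (Γ : Set Plane) : Prop :=
  (inside Γ).Nonempty ∧ frontier (body Γ) = Γ

/-- The unit tangent vector `T`. -/
def unitTangent (γ : ℝ → Plane) (t : ℝ) : Plane := ‖deriv γ t‖⁻¹ • deriv γ t

/-- The unit normal vector `N`, which is to the left of `T`. -/
def unitNormal (γ : ℝ → Plane) (t : ℝ) : Plane := rot (unitTangent γ t)

/-- The signed curvature `κ = det (γ', γ'') / |γ'|³`. -/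
def curvature (γ : ℝ → Plane) (t : ℝ) : ℝ :=
  (deriv γ t 0 * deriv (deriv γ) t 1 - deriv γ t 1 * deriv (deriv γ) t 0) / ‖deriv γ t‖ ^ 3

/-- The curvature center `γ + N / κ`, which exists where `κ ≠ 0`. It does not change when the
orientation is reversed, since this changes the sign of both `N` and `κ`. -/
def curvatureCenter (γ : ℝ → Plane) (t : ℝ) : Plane :=
  γ t + (curvature γ t)⁻¹ • unitNormal γ t

/-- The length of one period of `γ`. -/
def length (γ : ℝ → Plane) (ℓ : ℝ) : ℝ := ∫ t in (0 : ℝ)..ℓ, ‖deriv γ t‖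

/-- `δ(X) = inf_{p ∈ X} sup_{q ∈ X} d(p, q)`. -/
def minimax (X : Set Plane) : ℝ := ⨅ p : X, ⨆ q : X, dist (p : Plane) (q : Plane)

/-- The breadth of `X` in the direction of the unit vector `u`: the distance between the two
supporting lines of `X` that are orthogonal to `u`. -/
def breadth (X : Set Plane) (u : Plane) : ℝ :=
  (⨆ x : X, inner ℝ u (x : Plane)) - ⨅ x : X, inner ℝ u (x : Plane)

/-- The breadth of `X` is the same in all directions. -/
def HasConstantBreadth (X : Set Plane) : Prop :=
  ∃ b : ℝ, ∀ u : Plane, ‖u‖ = 1 → breadth X u = b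

end PlaneCurve

end

namespace PlaneCurve

open Set Filter Topology

/-! Fix `p ∈ Γ`. If the normal at `γ t ≠ p` passes through `p`, then `p = γ t + μ (c - γ t)` with
`c` the curvature center. As `c` is interior and both `p` and `γ t` are boundary points, `μ > 1`
(`one_lt_of_not_mem_interior`). Half the squared distance from `p` then has second derivative `|γ'|²
(1 - μ) < 0` at `t` (`second_deriv_neg`). Two strict local maxima would enclose another kind of
critical point, so `γ t` is the unique farthest point from `p` (`dist_lt_of_normal`).

Hence every normal chord, from `γ t` to `p`, has length at least `δ`, and the disc about `p` through
`γ t` contains `Γ`. So the tangent at `γ t` supports `Γ` and touches it only there, and the breadth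
orthogonal to it is at least the chord length, hence at least `δ` (`minimax_le_breadth`).

A linear function has critical points only at its maximum and minimum, so its variation along `Γ` is
twice the breadth. Averaging over directions gives Cauchy's formula `∫ breadth = 2 L` over `[0, 2π]`
(`integral_breadth`), hence `L ≥ π δ`. By continuity, equality forces breadth `δ` everywhere.
Conversely, constant breadth `b` gives `b ≤ δ`, since a breadth realized at `γ t` is at most the
distance to some point of `Γ`. -/

lemma inner_plane (v w : Plane) : inner ℝ v w = v 0 * w 0 + v 1 * w 1 := by
  simp [PiLp.inner_apply, Fin.sum_univ_two, mul_comm]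

lemma norm_sq_plane (v : Plane) : ‖v‖ ^ 2 = v 0 ^ 2 + v 1 ^ 2 := by
  rw [← real_inner_self_eq_norm_sq, inner_plane]; ring

lemma rot_apply_zero (v : Plane) : rot v 0 = -v 1 := rfl

lemma rot_apply_one (v : Plane) : rot v 1 = v 0 := rfl

lemma rot_smul (c : ℝ) (v : Plane) : rot (c • v) = c • rot v := by
  ext i; fin_cases i <;> simp [rot]

lemma inner_rot_self (v : Plane) : inner ℝ v (rot v) = 0 := by
  rw [inner_plane, rot_apply_zero, rot_apply_one]; ring

/-- A vector orthogonal to `v ≠ 0` is a multiple of `rot v`. -/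
lemma exists_eq_smul_rot {v w : Plane} (hv : v ≠ 0) (h : inner ℝ v w = 0) :
    ∃ c : ℝ, w = c • rot v := by
  have hv' : ‖v‖ ^ 2 ≠ 0 := by positivity
  rw [norm_sq_plane] at hv'
  rw [inner_plane] at h
  refine ⟨(v 0 * w 1 - v 1 * w 0) / (v 0 ^ 2 + v 1 ^ 2), ?_⟩
  ext i
  fin_cases i
  · simp only [Fin.zero_eta, PiLp.smul_apply, rot_apply_zero, smul_eq_mul]
    field_simp
    linear_combination v 0 * h
  · simp only [Fin.mk_one, PiLp.smul_apply, rot_apply_one, smul_eq_mul]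
    field_simp
    linear_combination v 1 * h

/-- In the plane, a vector orthogonal to `w ≠ 0` is a multiple of any unit vector orthogonal to
`w`. -/
lemma exists_eq_smul_of_inner_eq_zero {u v w : Plane} (hw : w ≠ 0) (hv : ‖v‖ = 1)
    (hv0 : inner ℝ v w = 0) (hu0 : inner ℝ u w = 0) : ∃ c : ℝ, u = c • v := by
  rw [real_inner_comm] at hv0 hu0
  obtain ⟨c, hc⟩ := exists_eq_smul_rot hw hu0
  obtain ⟨d, hd⟩ := exists_eq_smul_rot hw hv0
  have hd0 : d ≠ 0 := by
    rintro rfl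
    rw [hd, zero_smul, norm_zero] at hv
    exact zero_ne_one hv
  exact ⟨c / d, by rw [hd, smul_smul, div_mul_cancel₀ _ hd0, hc]⟩

/-! ### Lines through interior points of planar sets -/

/-- A line through an interior point of a convex set leaves the set only beyond that point. -/
lemma one_lt_of_not_mem_interior {K : Set Plane} (hK : Convex ℝ K) {x p c : Plane} {μ : ℝ}
    (hx : x ∈ K) (hx' : x ∉ interior K) (hp : p ∈ K) (hp' : p ∉ interior K)
    (hc : c ∈ interior K) (h : p - x = μ • (c - x)) (hμ : μ ≠ 0) : 1 < μ := by
  have hpx : p = x + μ • (c - x) := by rw [← h]; abel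
  by_contra! hle
  rcases lt_or_gt_of_ne hμ with hneg | hpos
  -- For `μ < 0`, `x` lies strictly between `p` and `c`; the parameter `t` below solves `x = p + t
  -- (c - p)`.
  · apply hx'
    have h1 : 0 < 1 - μ := by linarith
    have := hK.add_smul_sub_mem_interior hp hc (t := -μ / (1 - μ))
      ⟨by apply div_pos <;> linarith, by rw [div_le_one h1]; linarith⟩
    convert this using 1
    rw [hpx, show c - (x + μ • (c - x)) = (1 - μ) • (c - x) by module, smul_smul,
      div_mul_cancel₀ _ h1.ne']
    module
  · apply hp'
    rw [hpx]
    exact hK.add_smul_sub_mem_interior hx hc ⟨hpos, hle⟩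

/-- The ray from a point of a bounded set through an interior point meets the frontier beyond
the interior point. -/
lemma exists_frontier_on_ray {K : Set Plane} (hK : Bornology.IsBounded K) {x c : Plane}
    (hc : c ∈ interior K) (hxc : x ≠ c) :
    ∃ μ : ℝ, 1 < μ ∧ x + μ • (c - x) ∈ frontier K := by
  have hcx : 0 < ‖c - x‖ := norm_pos_iff.2 (sub_ne_zero.2 hxc.symm)
  obtain ⟨R, hR⟩ := hK.subset_closedBall x
  set g : ℝ → Plane := fun μ => x + μ • (c - x)
  have hg : Continuous g := by fun_prop
  -- Chosen so that `g b` has distance `|R| + 2 ‖c - x‖ > R` from `x`.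
  set b : ℝ := |R| / ‖c - x‖ + 2
  have hb : 1 < b := by have : 0 ≤ |R| / ‖c - x‖ := by positivity
                        simp only [b]; linarith
  have hgb : g b ∉ K := by
    intro hmem
    have h1 := hR hmem
    simp only [g, Metric.mem_closedBall, dist_eq_norm, add_sub_cancel_left, norm_smul,
      Real.norm_eq_abs] at h1
    rw [abs_of_pos (by linarith)] at h1
    have h2 : b * ‖c - x‖ = |R| + 2 * ‖c - x‖ := by simp only [b]; field_simp
    linarith [le_abs_self R]
  have hpre : (g '' Icc 1 b ∩ frontier K).Nonempty := by
    by_contra! hempty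
    obtain ⟨x, -, h1, h2⟩ := (isPreconnected_Icc.image g hg.continuousOn) (interior K)
      (closure K)ᶜ isOpen_interior isClosed_closure.isOpen_compl
      (fun x hx => by
        by_contra! hcon
        simp only [mem_union, mem_compl_iff, not_or, not_not] at hcon
        exact hempty.subset ⟨hx, hcon.2, hcon.1⟩)
      ⟨g 1, mem_image_of_mem _ ⟨le_rfl, hb.le⟩, by simpa [g] using hc⟩
      ⟨g b, mem_image_of_mem _ ⟨hb.le, le_rfl⟩, fun hcl => hempty.subset
        ⟨mem_image_of_mem _ ⟨hb.le, le_rfl⟩, hcl, fun h => hgb (interior_subset h)⟩⟩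
    exact h2 (interior_subset_closure h1)
  obtain ⟨_, ⟨μ, hμ, rfl⟩, hf⟩ := hpre
  refine ⟨μ, lt_of_le_of_ne hμ.1 ?_, hf⟩
  rintro rfl
  exact hf.2 (by simpa [g] using hc)

/-! ### Zeros and signs of real functions -/

/-- A function whose derivative is negative at each of its zeros has at most one zero. -/
lemma zero_unique_of_deriv_neg {g g' : ℝ → ℝ} {a b : ℝ} (hab : a < b)
    (hg : ∀ x, HasDerivAt g (g' x) x)
    (hneg : ∀ x ∈ Icc a b, g x = 0 → g' x < 0) (ha : g a = 0) (hb : g b = 0) : False := by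
  have hle : ∀ ⦃x⦄, x ∈ Icc a b → g x ≤ 0 :=
    image_le_of_deriv_right_lt_deriv_boundary (B := fun _ => 0) (B' := fun _ => 0)
      (fun x _ => (hg x).continuousAt.continuousWithinAt)
      (fun x _ => (hg x).hasDerivWithinAt) ha.le (fun x => hasDerivAt_const x 0)
      (fun x hx h => hneg x ⟨hx.1, hx.2.le⟩ h)
  -- Since `g ≤ 0 = g b` on the left of `b`, the left slopes at `b` are nonnegative, against `g' b <
  -- 0`.
  have hlim := (hasDerivAt_iff_tendsto_slope_left_right.1 (hg b)).1
  refine absurd (ge_of_tendsto hlim ?_) (not_le.2 (hneg b ⟨hab.le, le_rfl⟩ hb))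
  filter_upwards [Ioo_mem_nhdsLT hab] with x hx
  rw [slope_def_field, hb, sub_zero]
  have := hle ⟨hx.1.le, hx.2.le⟩
  exact div_nonneg_of_nonpos this (by linarith [hx.2])

/-- If a continuous function has no zero inside an interval, then the integral of its absolute
value is the absolute value of its integral. -/
lemma integral_abs_eq_abs_integral {g : ℝ → ℝ} (hg : Continuous g) {a b : ℝ} (hab : a ≤ b)
    (h0 : ∀ x ∈ Ioo a b, g x ≠ 0) : ∫ x in a..b, |g x| = |∫ x in a..b, g x| := by
  have hint : ∀ s : ℝ, ∀ F : ℝ → ℝ, (∀ x ∈ Ioo a b, F x = s * g x) →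
      ∫ x in a..b, F x = s * ∫ x in a..b, g x := by
    intro s F hF
    rw [← intervalIntegral.integral_const_mul, intervalIntegral.integral_of_le hab,
      intervalIntegral.integral_of_le hab, MeasureTheory.integral_Ioc_eq_integral_Ioo,
      MeasureTheory.integral_Ioc_eq_integral_Ioo]
    exact MeasureTheory.setIntegral_congr_fun measurableSet_Ioo hF
  have hnn : 0 ≤ ∫ x in a..b, |g x| :=
    intervalIntegral.integral_nonneg hab fun x _ => abs_nonneg _
  have hsign : (∀ x ∈ Ioo a b, 0 < g x) ∨ (∀ x ∈ Ioo a b, g x < 0) := by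
    by_contra! hcon
    obtain ⟨⟨x, hx, hgx⟩, y, hy, hgy⟩ := hcon
    obtain ⟨z, hz, hz0⟩ := (isPreconnected_Ioo (a := a) (b := b)).intermediate_value hx hy
      hg.continuousOn ⟨hgx, hgy⟩
    exact h0 z hz hz0
  rcases hsign with h | h
  · have := hint 1 (fun x => |g x|) (fun x hx => by rw [abs_of_pos (h x hx), one_mul])
    rw [this, one_mul] at hnn ⊢
    rw [abs_of_nonneg hnn]
  · have := hint (-1) (fun x => |g x|) (fun x hx => by rw [abs_of_neg (h x hx)]; ring)
    rw [this] at hnn ⊢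
    rw [abs_of_nonpos (by linarith)]; ring

/-! ### Closed regular curves -/

namespace IsClosedRegularC2Param

variable {Γ : Set Plane} {γ : ℝ → Plane} {ℓ : ℝ}

lemma hasDerivAt (hγ : IsClosedRegularC2Param Γ γ ℓ) (t : ℝ) :
    HasDerivAt γ (deriv γ t) t :=
  (hγ.contDiff.differentiable (by norm_num) t).hasDerivAt

lemma contDiff_deriv (hγ : IsClosedRegularC2Param Γ γ ℓ) : ContDiff ℝ 1 (deriv γ) :=
  ((contDiff_succ_iff_deriv (n := 1)).1 (one_add_one_eq_two (R := WithTop ℕ∞) ▸ hγ.contDiff)).2.2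

lemma hasDerivAt_deriv (hγ : IsClosedRegularC2Param Γ γ ℓ) (t : ℝ) :
    HasDerivAt (deriv γ) (deriv (deriv γ) t) t :=
  (hγ.contDiff_deriv.differentiable (by norm_num) t).hasDerivAt

lemma continuous_deriv (hγ : IsClosedRegularC2Param Γ γ ℓ) : Continuous (deriv γ) :=
  hγ.contDiff_deriv.continuous

lemma periodic_deriv (hγ : IsClosedRegularC2Param Γ γ ℓ) : Function.Periodic (deriv γ) ℓ := by
  intro t
  rw [← deriv_comp_add_const, hγ.periodic.funext]

lemma mem (hγ : IsClosedRegularC2Param Γ γ ℓ) (t : ℝ) : γ t ∈ Γ :=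
  hγ.range_eq ▸ mem_range_self t

lemma isCompact (hγ : IsClosedRegularC2Param Γ γ ℓ) : IsCompact Γ :=
  hγ.range_eq ▸ hγ.periodic.compact_of_continuous hγ.period_pos.ne' hγ.contDiff.continuous

lemma forall_mem (hγ : IsClosedRegularC2Param Γ γ ℓ) {P : Plane → Prop} :
    (∀ x ∈ Γ, P x) ↔ ∀ t, P (γ t) := by
  rw [← hγ.range_eq, forall_mem_range]

/-- The parametrization is injective on every half-open interval of the length of the period. -/
lemma eq_of_mem_Ico (hγ : IsClosedRegularC2Param Γ γ ℓ) {c a b : ℝ}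
    (ha : a ∈ Ico c (c + ℓ)) (hb : b ∈ Ico c (c + ℓ)) (h : γ a = γ b) : a = b := by
  have key : ∀ x, γ (toIcoMod hγ.period_pos 0 x) = γ x := fun x => hγ.periodic.sub_zsmul_eq _
  have hmem : ∀ x, toIcoMod hγ.period_pos 0 x ∈ Ico 0 ℓ := fun x => by
    simpa using toIcoMod_mem_Ico hγ.period_pos 0 x
  have h0 := hγ.injOn (hmem a) (hmem b) (by rw [key, key, h])
  have hc : toIcoMod hγ.period_pos c a = toIcoMod hγ.period_pos c b :=
    toIcoMod_eq_toIcoMod _ |>.2 ((toIcoMod_eq_toIcoMod _).1 h0)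
  rwa [(toIcoMod_eq_self _).2 ha, (toIcoMod_eq_self _).2 hb] at hc

/-- A continuous function of the points of the curve attains its maximum. -/
lemma exists_forall_le (hγ : IsClosedRegularC2Param Γ γ ℓ) {f : Plane → ℝ} (hf : Continuous f) :
    ∃ t, ∀ s, f (γ s) ≤ f (γ t) := by
  obtain ⟨x, hx, hmax⟩ := hγ.isCompact.exists_isMaxOn ⟨_, hγ.mem 0⟩ hf.continuousOn
  obtain ⟨t, rfl⟩ := hγ.range_eq.symm ▸ hx
  exact ⟨t, fun s => hmax (hγ.mem s)⟩

lemma hasDerivAt_inner_const (hγ : IsClosedRegularC2Param Γ γ ℓ) (u : Plane) (t : ℝ) :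
    HasDerivAt (fun s => inner ℝ u (γ s)) (inner ℝ u (deriv γ t)) t := by
  simpa using (hasDerivAt_const t u).inner ℝ (hγ.hasDerivAt t)

lemma hasDerivAt_norm_sub_sq (hγ : IsClosedRegularC2Param Γ γ ℓ) (p : Plane) (t : ℝ) :
    HasDerivAt (fun s => ‖γ s - p‖ ^ 2) (2 * inner ℝ (deriv γ t) (γ t - p)) t := by
  convert ((hγ.hasDerivAt t).sub_const p).norm_sq using 1
  rw [real_inner_comm]

lemma hasDerivAt_inner_deriv_sub (hγ : IsClosedRegularC2Param Γ γ ℓ) (p : Plane) (t : ℝ) :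
    HasDerivAt (fun s => inner ℝ (deriv γ s) (γ s - p))
      (‖deriv γ t‖ ^ 2 + inner ℝ (deriv (deriv γ) t) (γ t - p)) t := by
  rw [← real_inner_self_eq_norm_sq]
  exact (hγ.hasDerivAt_deriv t).inner ℝ ((hγ.hasDerivAt t).sub_const p)

end IsClosedRegularC2Param

/-! ### Normals and farthest points -/

/-- A closed regular convex curve of class `C²` all of whose curvature centers lie inside. -/
structure IsCentered (Γ : Set Plane) (γ : ℝ → Plane) (ℓ : ℝ) : Prop
    extends IsClosedRegularC2Param Γ γ ℓ where
  frontier_eq : frontier (body Γ) = Γ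
  curvature_ne : ∀ t, curvature γ t ≠ 0
  center_mem : ∀ t, curvatureCenter γ t ∈ inside Γ

lemma curvatureCenter_sub (γ : ℝ → Plane) (t : ℝ) :
    curvatureCenter γ t - γ t = ((curvature γ t)⁻¹ * ‖deriv γ t‖⁻¹) • rot (deriv γ t) := by
  rw [curvatureCenter, unitNormal, unitTangent, rot_smul, smul_smul, add_sub_cancel_left]

namespace IsCentered

variable {Γ : Set Plane} {γ : ℝ → Plane} {ℓ : ℝ}

lemma mem_body (_hγ : IsCentered Γ γ ℓ) {x : Plane} (hx : x ∈ Γ) : x ∈ body Γ :=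
  subset_convexHull ℝ Γ hx

lemma not_mem_interior (hγ : IsCentered Γ γ ℓ) {x : Plane} (hx : x ∈ Γ) :
    x ∉ interior (body Γ) := by
  rw [← hγ.frontier_eq] at hx
  exact hx.2

lemma norm_deriv_pos (hγ : IsCentered Γ γ ℓ) (t : ℝ) : 0 < ‖deriv γ t‖ :=
  norm_pos_iff.2 (hγ.regular t)

/-- A point of the curve on a normal lies beyond the curvature center. -/
lemma exists_beyond_center (hγ : IsCentered Γ γ ℓ) {p : Plane} (hp : p ∈ Γ) {t : ℝ}
    (hne : γ t ≠ p) (h : inner ℝ (deriv γ t) (γ t - p) = 0) :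
    ∃ μ : ℝ, 1 < μ ∧ p - γ t = μ • (curvatureCenter γ t - γ t) := by
  obtain ⟨c, hc⟩ := exists_eq_smul_rot (hγ.regular t) h
  have hd := (hγ.norm_deriv_pos t).ne'
  have hk := hγ.curvature_ne t
  have heq : p - γ t = (-c * curvature γ t * ‖deriv γ t‖) • (curvatureCenter γ t - γ t) := by
    rw [curvatureCenter_sub, smul_smul, ← neg_sub, hc, ← neg_smul]
    congr 1
    field_simp
  refine ⟨_, one_lt_of_not_mem_interior (convex_convexHull ℝ Γ) (hγ.mem_body (hγ.mem t))
    (hγ.not_mem_interior (hγ.mem t)) (hγ.mem_body hp) (hγ.not_mem_interior hp)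
    (hγ.center_mem t) heq ?_, heq⟩
  intro h0
  rw [h0, zero_smul, sub_eq_zero] at heq
  exact hne heq.symm

/-- Second-order contact with the osculating circle: the squared distance from the curvature center,
held fixed, has vanishing second derivative at `t`. -/
lemma inner_deriv_deriv (hγ : IsCentered Γ γ ℓ) (t : ℝ) :
    inner ℝ (deriv (deriv γ) t) (curvatureCenter γ t - γ t) = ‖deriv γ t‖ ^ 2 := by
  have hd := (hγ.norm_deriv_pos t).ne'
  have hk := hγ.curvature_ne t
  have hdet : inner ℝ (deriv (deriv γ) t) (rot (deriv γ t)) =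
      curvature γ t * ‖deriv γ t‖ ^ 3 := by
    rw [curvature, div_mul_cancel₀ _ (pow_ne_zero 3 hd), inner_plane, rot_apply_zero,
      rot_apply_one]
    ring
  rw [curvatureCenter_sub, inner_smul_right, hdet]
  field_simp

/-- Every critical point of the distance from a point of the curve is a strict local maximum. -/
lemma second_deriv_neg (hγ : IsCentered Γ γ ℓ) {p : Plane} (hp : p ∈ Γ) {t : ℝ}
    (hne : γ t ≠ p) (h : inner ℝ (deriv γ t) (γ t - p) = 0) :
    ‖deriv γ t‖ ^ 2 + inner ℝ (deriv (deriv γ) t) (γ t - p) < 0 := by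
  obtain ⟨μ, hμ, heq⟩ := hγ.exists_beyond_center hp hne h
  rw [← neg_sub, heq, inner_neg_right, inner_smul_right, hγ.inner_deriv_deriv]
  nlinarith [hγ.norm_deriv_pos t, pow_pos (hγ.norm_deriv_pos t) 2]

/-- The distance from a point `p` of the curve has only one critical point besides `p`. -/
lemma critical_unique (hγ : IsCentered Γ γ ℓ) {p : Plane} (hp : p ∈ Γ) {s t : ℝ}
    (hs : γ s ≠ p) (hs0 : inner ℝ (deriv γ s) (γ s - p) = 0)
    (ht : γ t ≠ p) (ht0 : inner ℝ (deriv γ t) (γ t - p) = 0) : γ s = γ t := by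
  obtain ⟨c, rfl⟩ := hγ.range_eq.symm ▸ hp
  -- Both parameters move into the period starting at `c`, where `γ c = p`, so that `p` is not met
  -- between them. Pairing `γ` with `γ'` carries the critical point conditions along.
  have hF : Function.Periodic (fun x => (γ x, deriv γ x)) ℓ := fun x => by
    simp only [hγ.periodic x, hγ.periodic_deriv x]
  obtain ⟨s', hs', hss⟩ := hF.exists_mem_Ico hγ.period_pos s c
  obtain ⟨t', ht', htt⟩ := hF.exists_mem_Ico hγ.period_pos t c
  simp only [Prod.mk.injEq] at hss htt
  rw [hss.1, hss.2] at hs0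
  rw [htt.1, htt.2] at ht0
  rw [hss.1] at hs ⊢
  rw [htt.1] at ht ⊢
  clear hss htt s t
  wlog hle : s' ≤ t' generalizing s' t'
  · exact (this t' ht ht0 ht' s' hs hs0 hs' (le_of_not_ge hle)).symm
  rcases hle.eq_or_lt with rfl | hlt
  · rfl
  refine (zero_unique_of_deriv_neg hlt (hγ.hasDerivAt_inner_deriv_sub (γ c)) ?_ hs0 ht0).elim
  intro x hx h0
  refine hγ.second_deriv_neg hp (fun hxc => ?_) h0
  have hcx : c = x := hγ.eq_of_mem_Ico ⟨le_rfl, by linarith [hγ.period_pos]⟩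
    ⟨hs'.1.trans hx.1, hx.2.trans_lt ht'.2⟩ hxc.symm
  have : c = s' := le_antisymm hs'.1 (hcx ▸ hx.1)
  exact hs (by rw [this])

/-- If the normal at `γ t` passes through the point `p ≠ γ t` of the curve, then `γ t` is the only
point of the curve of greatest distance from `p`. -/
lemma dist_lt_of_normal (hγ : IsCentered Γ γ ℓ) {p : Plane} (hp : p ∈ Γ) {t : ℝ}
    (ht : γ t ≠ p) (ht0 : inner ℝ (deriv γ t) (γ t - p) = 0) {s : ℝ} (hs : γ s ≠ γ t) :
    ‖γ s - p‖ < ‖γ t - p‖ := by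
  -- A farthest point is critical, and it is not `p` because `γ t` has positive distance from `p`.
  have hcrit : ∀ r, (∀ s, ‖γ s - p‖ ≤ ‖γ r - p‖) → γ r = γ t := by
    intro r hr
    refine hγ.critical_unique hp ?_ ?_ ht ht0
    · intro h
      have := hr t
      rw [h, sub_self, norm_zero] at this
      exact ht (sub_eq_zero.1 (norm_le_zero_iff.1 this))
    · have hloc : IsLocalMax (fun s => ‖γ s - p‖ ^ 2) r :=
        Eventually.of_forall fun s => pow_le_pow_left₀ (norm_nonneg _) (hr s) 2
      have := hloc.hasDerivAt_eq_zero (hγ.hasDerivAt_norm_sub_sq p r)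
      linarith
  obtain ⟨r, hr⟩ := hγ.exists_forall_le (f := fun x => ‖x - p‖) (by fun_prop)
  have hrt := hcrit r hr
  rw [hrt] at hr
  refine lt_of_le_of_ne (hr s) fun h => hs (hcrit s fun x => ?_)
  rw [h]
  exact hr x

/-- For every point `γ t` of the curve there is a point `p` of the curve on its normal such that
`γ t` is the only point of the curve of greatest distance from `p`. -/
lemma exists_normal_chord (hγ : IsCentered Γ γ ℓ) (t : ℝ) :
    ∃ p ∈ Γ, γ t ≠ p ∧ inner ℝ (deriv γ t) (γ t - p) = 0 ∧
      ∀ s, γ s ≠ γ t → ‖γ s - p‖ < ‖γ t - p‖ := by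
  have hne : γ t ≠ curvatureCenter γ t := fun h =>
    hγ.not_mem_interior (hγ.mem t) (h ▸ hγ.center_mem t)
  have hbdd : Bornology.IsBounded (body Γ) := isBounded_convexHull.2 hγ.isCompact.isBounded
  obtain ⟨μ, hμ, hp⟩ := exists_frontier_on_ray hbdd (hγ.center_mem t) hne
  rw [hγ.frontier_eq] at hp
  have hsub : γ t - (γ t + μ • (curvatureCenter γ t - γ t)) =
      -(μ • (curvatureCenter γ t - γ t)) := by abel
  have ht : γ t ≠ γ t + μ • (curvatureCenter γ t - γ t) := by
    rw [Ne, left_eq_add, smul_eq_zero, sub_eq_zero]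
    rintro (h | h)
    · linarith
    · exact hne h.symm
  have h0 : inner ℝ (deriv γ t) (γ t - (γ t + μ • (curvatureCenter γ t - γ t))) = 0 := by
    rw [hsub, curvatureCenter_sub, inner_neg_right, inner_smul_right, inner_smul_right,
      inner_rot_self]
    simp
  exact ⟨_, hp, ht, h0, fun s hs => hγ.dist_lt_of_normal hp ht h0 hs⟩

/-- At a critical point of a linear function on the curve, the function has a strict global
extremum. The corresponding width of the curve is at least the length of the normal chord. -/
lemma exists_unit_normal (hγ : IsCentered Γ γ ℓ) (t : ℝ) :
    ∃ v : Plane, ‖v‖ = 1 ∧ inner ℝ v (deriv γ t) = 0 ∧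
      (∀ s, γ s ≠ γ t → inner ℝ v (γ s) < inner ℝ v (γ t)) ∧
      ∃ p ∈ Γ, (∀ q ∈ Γ, dist p q ≤ dist p (γ t)) ∧
        inner ℝ v (γ t) - inner ℝ v p = dist p (γ t) := by
  obtain ⟨p, hp, hne, h0, hlt⟩ := hγ.exists_normal_chord t
  have hpos : 0 < ‖γ t - p‖ := norm_pos_iff.2 (sub_ne_zero.2 hne)
  set v : Plane := ‖γ t - p‖⁻¹ • (γ t - p) with hv
  have hnv : ‖v‖ = 1 := norm_smul_inv_norm (sub_ne_zero.2 hne)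
  have hvt : inner ℝ v (γ t - p) = ‖γ t - p‖ := by
    rw [hv, real_inner_smul_left, real_inner_self_eq_norm_sq]
    field_simp
  refine ⟨v, hnv, ?_, ?_, p, hp, ?_, ?_⟩
  · rw [hv, real_inner_smul_left, real_inner_comm, h0, mul_zero]
  -- `⟨v, γ s - p⟩ ≤ |γ s - p| < |γ t - p| = ⟨v, γ t - p⟩`.
  · intro s hs
    have h1 : inner ℝ v (γ s - p) ≤ ‖γ s - p‖ := by
      simpa [hnv] using real_inner_le_norm v (γ s - p)
    have h2 := hlt s hs
    rw [inner_sub_right] at h1 hvt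
    linarith
  · rw [hγ.forall_mem]
    intro s
    rw [dist_comm p, dist_comm p, dist_eq_norm, dist_eq_norm]
    by_cases hs : γ s = γ t
    · rw [hs]
    · exact (hlt s hs).le
  · rw [← inner_sub_right, hvt, dist_comm, dist_eq_norm]

end IsCentered

/-! ### Averaging over directions -/

/-- The unit vector of direction `φ`. -/
noncomputable def unitVec (φ : ℝ) : Plane := !₂[Real.cos φ, Real.sin φ]

lemma inner_unitVec (φ : ℝ) (v : Plane) :
    inner ℝ (unitVec φ) v = Real.cos φ * v 0 + Real.sin φ * v 1 := by
  rw [inner_plane]; rfl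

lemma norm_unitVec (φ : ℝ) : ‖unitVec φ‖ = 1 := by
  have h : ‖unitVec φ‖ ^ 2 = 1 := by
    rw [← real_inner_self_eq_norm_sq, inner_unitVec]
    simp only [unitVec, PiLp.toLp_apply, Matrix.cons_val_zero, Matrix.cons_val_one]
    nlinarith [Real.sin_sq_add_cos_sq φ]
  rw [← sq_eq_sq₀ (norm_nonneg _) zero_le_one, h, one_pow]

/-- Every unit vector has a direction in `[0, 2π]`. -/
lemma exists_eq_unitVec {u : Plane} (hu : ‖u‖ = 1) :
    ∃ φ ∈ Icc (0 : ℝ) (2 * Real.pi), u = unitVec φ := by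
  set z : ℂ := ⟨u 0, u 1⟩
  have hz : ‖z‖ = 1 := by
    rw [← hu, ← sq_eq_sq₀ (norm_nonneg _) (norm_nonneg _), norm_sq_plane, Complex.sq_norm,
      Complex.normSq_apply]
    ring
  have hper : Function.Periodic unitVec (2 * Real.pi) := fun x => by
    simp [unitVec]
  obtain ⟨φ, hφ, h⟩ := hper.exists_mem_Ico₀ Real.two_pi_pos z.arg
  refine ⟨φ, Ico_subset_Icc_self hφ, ?_⟩
  rw [← h]
  ext i
  fin_cases i
  · simpa [hz, unitVec] using (Complex.norm_mul_cos_arg z).symm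
  · simpa [hz, unitVec] using (Complex.norm_mul_sin_arg z).symm

lemma continuous_unitVec : Continuous unitVec := by
  unfold unitVec
  fun_prop

lemma integral_abs_cos : ∫ φ in (0 : ℝ)..2 * Real.pi, |Real.cos φ| = 4 := by
  have hper : Function.Periodic (fun φ => |Real.cos φ|) Real.pi := fun x => by
    simp [Real.cos_add_pi]
  have hint : ∀ a b, IntervalIntegrable (fun φ => |Real.cos φ|) MeasureTheory.volume a b :=
    fun a b => (Real.continuous_cos.abs).intervalIntegrable a b
  have hpi := Real.pi_pos
  have hbase : ∫ φ in (-(Real.pi / 2))..(-(Real.pi / 2) + Real.pi), |Real.cos φ| = 2 := by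
    rw [show -(Real.pi / 2) + Real.pi = Real.pi / 2 by ring,
      integral_abs_eq_abs_integral Real.continuous_cos (by linarith)
        (fun x hx => (Real.cos_pos_of_mem_Ioo hx).ne'), integral_cos]
    norm_num
  rw [← intervalIntegral.integral_add_adjacent_intervals (hint 0 Real.pi) (hint _ _),
    show 2 * Real.pi = Real.pi + Real.pi by ring,
    hper.intervalIntegral_add_eq Real.pi (-(Real.pi / 2)), hbase]
  have := hper.intervalIntegral_add_eq 0 (-(Real.pi / 2))
  rw [zero_add] at this
  rw [this, hbase]
  norm_num

/-- The norm of a vector is the mean value of its projections. -/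
lemma integral_abs_inner_unitVec (v : Plane) :
    ∫ φ in (0 : ℝ)..2 * Real.pi, |inner ℝ (unitVec φ) v| = 4 * ‖v‖ := by
  set z : ℂ := ⟨v 0, v 1⟩
  have hz : ‖z‖ = ‖v‖ := by
    rw [← sq_eq_sq₀ (norm_nonneg _) (norm_nonneg _), norm_sq_plane, Complex.sq_norm,
      Complex.normSq_apply]
    ring
  have h0 : v 0 = ‖v‖ * Real.cos z.arg := by rw [← hz, Complex.norm_mul_cos_arg]
  have h1 : v 1 = ‖v‖ * Real.sin z.arg := by rw [← hz, Complex.norm_mul_sin_arg]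
  have hcos : ∀ φ, |inner ℝ (unitVec φ) v| = ‖v‖ * |Real.cos (φ - z.arg)| := by
    intro φ
    rw [inner_unitVec, h0, h1, Real.cos_sub, ← abs_norm v, ← abs_mul, abs_norm]
    congr 1
    ring
  have hper : Function.Periodic (fun φ => |Real.cos φ|) (2 * Real.pi) := fun x => by
    simp [Real.cos_add_two_pi]
  simp_rw [hcos]
  rw [intervalIntegral.integral_const_mul,
    intervalIntegral.integral_comp_sub_right (fun φ => |Real.cos φ|),
    show 2 * Real.pi - z.arg = (0 - z.arg) + 2 * Real.pi by ring,
    hper.intervalIntegral_add_eq (0 - z.arg) 0, zero_add, integral_abs_cos]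
  ring

variable {Γ : Set Plane} {γ : ℝ → Plane} {ℓ : ℝ}

lemma IsClosedRegularC2Param.continuous_abs_inner_deriv (hγ : IsClosedRegularC2Param Γ γ ℓ) :
    Continuous (Function.uncurry fun φ t => |inner ℝ (unitVec φ) (deriv γ t)|) :=
  ((continuous_unitVec.comp continuous_fst).inner
    (hγ.continuous_deriv.comp continuous_snd)).abs

/-- The length of a closed curve in terms of the total variations of its projections. -/
lemma IsClosedRegularC2Param.integral_variation (hγ : IsClosedRegularC2Param Γ γ ℓ) :
    ∫ φ in (0 : ℝ)..2 * Real.pi, ∫ t in (0 : ℝ)..ℓ, |inner ℝ (unitVec φ) (deriv γ t)| =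
      4 * length γ ℓ := by
  rw [MeasureTheory.intervalIntegral_intervalIntegral_swap]
  · simp_rw [integral_abs_inner_unitVec]
    rw [intervalIntegral.integral_const_mul, length]
  · exact (hγ.continuous_abs_inner_deriv.continuousOn.integrableOn_compact
      (isCompact_uIcc.prod isCompact_uIcc)).mono_set
      (prod_mono uIoc_subset_uIcc uIoc_subset_uIcc)

lemma IsClosedRegularC2Param.breadth_eq (hγ : IsClosedRegularC2Param Γ γ ℓ) {u : Plane}
    {a b : ℝ} (ha : ∀ s, inner ℝ u (γ s) ≤ inner ℝ u (γ a))
    (hb : ∀ s, inner ℝ u (γ b) ≤ inner ℝ u (γ s)) :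
    breadth Γ u = inner ℝ u (γ a) - inner ℝ u (γ b) := by
  rw [← hγ.forall_mem (P := fun x => inner ℝ u x ≤ inner ℝ u (γ a))] at ha
  rw [← hγ.forall_mem (P := fun x => inner ℝ u (γ b) ≤ inner ℝ u x)] at hb
  have : Nonempty Γ := ⟨⟨_, hγ.mem 0⟩⟩
  rw [breadth]
  congr 1
  · exact le_antisymm (ciSup_le fun x => ha x x.2)
      (le_ciSup (f := fun x : Γ => inner ℝ u (x : Plane))
        ⟨_, forall_mem_range.2 fun x => ha x x.2⟩ ⟨γ a, hγ.mem a⟩)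
  · exact le_antisymm (ciInf_le (f := fun x : Γ => inner ℝ u (x : Plane))
        ⟨_, forall_mem_range.2 fun x => hb x x.2⟩ ⟨γ b, hγ.mem b⟩)
      (le_ciInf fun x => hb x x.2)

lemma IsClosedRegularC2Param.minimax_le (_hγ : IsClosedRegularC2Param Γ γ ℓ) {p : Plane}
    (hp : p ∈ Γ) {d : ℝ} (h : ∀ q ∈ Γ, dist p q ≤ d) : minimax Γ ≤ d := by
  have : Nonempty Γ := ⟨⟨p, hp⟩⟩
  refine (ciInf_le ⟨0, forall_mem_range.2 fun x => Real.iSup_nonneg fun y => dist_nonneg⟩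
    (⟨p, hp⟩ : Γ)).trans (ciSup_le fun q => h q q.2)

lemma IsClosedRegularC2Param.le_minimax (hγ : IsClosedRegularC2Param Γ γ ℓ) {d : ℝ}
    (h : ∀ p ∈ Γ, ∃ q ∈ Γ, d ≤ dist p q) : d ≤ minimax Γ := by
  have : Nonempty Γ := ⟨⟨_, hγ.mem 0⟩⟩
  refine le_ciInf fun p => ?_
  obtain ⟨q, hq, hd⟩ := h p p.2
  obtain ⟨C, hC⟩ := Metric.isBounded_iff.1 hγ.isCompact.isBounded
  exact le_ciSup_of_le ⟨C, forall_mem_range.2 fun y => hC p.2 y.2⟩ (⟨q, hq⟩ : Γ) hd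

/-! ### Breadth, variation and Cauchy's formula -/

namespace IsCentered

/-- At a critical point of a linear function on the curve, the function has a strict global
maximum or a strict global minimum. -/
lemma strict_extremum (hγ : IsCentered Γ γ ℓ) {u : Plane} (hu : u ≠ 0) {t : ℝ}
    (h : inner ℝ u (deriv γ t) = 0) :
    (∀ s, γ s ≠ γ t → inner ℝ u (γ s) < inner ℝ u (γ t)) ∨
      ∀ s, γ s ≠ γ t → inner ℝ u (γ t) < inner ℝ u (γ s) := by
  obtain ⟨v, hv, hv0, hlt, -⟩ := hγ.exists_unit_normal t
  obtain ⟨c, rfl⟩ := exists_eq_smul_of_inner_eq_zero (hγ.regular t) hv hv0 h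
  have hc : c ≠ 0 := by
    rintro rfl
    exact hu (zero_smul ℝ v)
  simp_rw [real_inner_smul_left]
  rcases lt_or_gt_of_ne hc with h | h
  · exact Or.inr fun s hs => mul_lt_mul_of_neg_left (hlt s hs) h
  · exact Or.inl fun s hs => mul_lt_mul_of_pos_left (hlt s hs) h

/-- The variation of a linear function along the curve is twice the breadth. -/
lemma variation_eq (hγ : IsCentered Γ γ ℓ) {u : Plane} (hu : u ≠ 0) :
    ∫ t in (0 : ℝ)..ℓ, |inner ℝ u (deriv γ t)| = 2 * breadth Γ u := by
  have hℓ := hγ.period_pos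
  have hcont : Continuous fun x : Plane => inner ℝ u x := by fun_prop
  have hcont' : Continuous fun t => inner ℝ u (deriv γ t) := hcont.comp hγ.continuous_deriv
  obtain ⟨a, ha⟩ := hγ.exists_forall_le hcont
  obtain ⟨b', hb'⟩ := hγ.exists_forall_le hcont.neg
  obtain ⟨b, hb, hbb⟩ := hγ.periodic.exists_mem_Ico hℓ b' a
  have hbmin : ∀ s, inner ℝ u (γ b) ≤ inner ℝ u (γ s) := fun s => by
    rw [← hbb]; exact neg_le_neg_iff.1 (hb' s)
  -- Otherwise the linear function is constant on `Γ`, against the strict extremum at `a`; half a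
  -- period further lies a different point.
  have hne : γ b ≠ γ a := by
    intro hba
    have hall : ∀ s, inner ℝ u (γ s) = inner ℝ u (γ a) := fun s =>
      le_antisymm (ha s) (hba ▸ hbmin s)
    have ha0 : inner ℝ u (deriv γ a) = 0 := by
      have hloc : IsLocalMax (fun s => inner ℝ u (γ s)) a := Eventually.of_forall ha
      exact hloc.hasDerivAt_eq_zero (hγ.hasDerivAt_inner_const u a)
    have hmid : γ (a + ℓ / 2) ≠ γ a := fun h => by
      have := hγ.eq_of_mem_Ico (c := a) ⟨by linarith, by linarith⟩ ⟨le_rfl, by linarith⟩ h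
      linarith
    rcases hγ.strict_extremum hu ha0 with h | h
    · exact (h _ hmid).ne (hall _)
    · exact (h _ hmid).ne' (hall _)
  have hab : a < b := lt_of_le_of_ne hb.1 fun h => hne (by rw [h])
  have hcrit : ∀ s, inner ℝ u (deriv γ s) = 0 → γ s = γ a ∨ γ s = γ b := by
    intro s hs
    rcases hγ.strict_extremum hu hs with h | h
    · left
      by_contra hcon
      exact (h a (Ne.symm hcon)).not_ge (ha s)
    · right
      by_contra hcon
      exact (h b (Ne.symm hcon)).not_ge (hbmin s)
  -- The derivative thus keeps its sign on each of the arcs `(a, b)` and `(b, a + ℓ)`, and each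
  -- contributes the breadth.
  have hcrit' : ∀ s ∈ Ioo a (a + ℓ), s ≠ b → inner ℝ u (deriv γ s) ≠ 0 := by
    intro s hs hsb h0
    rcases hcrit s h0 with h | h
    · exact hs.1.ne' (hγ.eq_of_mem_Ico ⟨hs.1.le, hs.2⟩ ⟨le_rfl, by linarith⟩ h)
    · exact hsb (hγ.eq_of_mem_Ico ⟨hs.1.le, hs.2⟩ hb h)
  have hper : Function.Periodic (fun t => |inner ℝ u (deriv γ t)|) ℓ := fun t => by
    simp only [hγ.periodic_deriv t]
  have hftc : ∀ x y : ℝ, ∫ t in x..y, inner ℝ u (deriv γ t) =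
      inner ℝ u (γ y) - inner ℝ u (γ x) := fun x y =>
    intervalIntegral.integral_eq_sub_of_hasDerivAt
      (fun t _ => hγ.hasDerivAt_inner_const u t) (hcont'.intervalIntegrable _ _)
  have hshift := hper.intervalIntegral_add_eq 0 a
  rw [zero_add] at hshift
  rw [hshift, ← intervalIntegral.integral_add_adjacent_intervals
      (hcont'.abs.intervalIntegrable a b) (hcont'.abs.intervalIntegrable b (a + ℓ)),
    integral_abs_eq_abs_integral hcont' hab.le
      (fun x hx => hcrit' x ⟨hx.1, hx.2.trans hb.2⟩ hx.2.ne),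
    integral_abs_eq_abs_integral hcont' hb.2.le
      (fun x hx => hcrit' x ⟨hab.trans hx.1, hx.2⟩ hx.1.ne'),
    hftc, hftc, hγ.periodic a, hγ.breadth_eq ha hbmin, abs_sub_comm, ← two_mul,
    abs_of_nonneg (sub_nonneg.2 (hbmin a))]

/-- The breadth in every direction is at least the minimax distance. -/
lemma minimax_le_breadth (hγ : IsCentered Γ γ ℓ) {u : Plane} (hu : ‖u‖ = 1) :
    minimax Γ ≤ breadth Γ u := by
  have hcont : ∀ u : Plane, Continuous fun x : Plane => inner ℝ u x := fun u => by fun_prop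
  obtain ⟨a, ha⟩ := hγ.exists_forall_le (hcont u)
  obtain ⟨b, hb⟩ := hγ.exists_forall_le (hcont u).neg
  have hloc : IsLocalMax (fun s => inner ℝ u (γ s)) a := Eventually.of_forall ha
  have ha0 := hloc.hasDerivAt_eq_zero (hγ.hasDerivAt_inner_const u a)
  obtain ⟨v, hv, hv0, -, p, hp, hdist, hvp⟩ := hγ.exists_unit_normal a
  refine (hγ.minimax_le hp hdist).trans ?_
  have hmin : ∀ x ∈ Γ, inner ℝ u (γ b) ≤ inner ℝ u x :=
    hγ.forall_mem.2 fun s => neg_le_neg_iff.1 (hb s)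
  have hmax : ∀ x ∈ Γ, inner ℝ u x ≤ inner ℝ u (γ a) := hγ.forall_mem.2 ha
  rw [hγ.breadth_eq ha fun s => hmin _ (hγ.mem s)]
  refine le_trans ?_ (sub_le_sub_left (hmin p hp) _)
  have hpos := hmax p hp
  obtain ⟨c, rfl⟩ := exists_eq_smul_of_inner_eq_zero (hγ.regular a) hv hv0 ha0
  rw [norm_smul, hv, mul_one, Real.norm_eq_abs] at hu
  rw [real_inner_smul_left, real_inner_smul_left] at hpos ⊢
  -- Here `u = ±v`. If `u = -v`, maximality at `γ a` makes the chord length nonpositive, and the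
  -- bound is trivial.
  rcases eq_or_eq_neg_of_abs_eq hu with rfl | rfl
  · linarith
  · linarith [dist_nonneg (x := p) (y := γ a)]

/-- If the breadth is constant, it is at most the minimax distance. -/
lemma le_minimax_of_breadth_eq (hγ : IsCentered Γ γ ℓ) {b : ℝ}
    (hb : ∀ u : Plane, ‖u‖ = 1 → breadth Γ u = b) : b ≤ minimax Γ := by
  refine hγ.le_minimax (hγ.forall_mem.2 fun t => ?_)
  -- The breadth in the normal direction `v` is the projection of `γ t - γ r` on `v`, hence at most
  -- the distance.
  obtain ⟨v, hv, -, hlt, -⟩ := hγ.exists_unit_normal t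
  obtain ⟨r, hr⟩ := hγ.exists_forall_le
    (show Continuous fun x : Plane => -inner ℝ v x by fun_prop)
  refine ⟨γ r, hγ.mem r, ?_⟩
  have hmax : ∀ s, inner ℝ v (γ s) ≤ inner ℝ v (γ t) := fun s => by
    by_cases hs : γ s = γ t
    · rw [hs]
    · exact (hlt s hs).le
  rw [← hb v hv, hγ.breadth_eq hmax fun s => neg_le_neg_iff.1 (hr s), ← inner_sub_right,
    dist_eq_norm]
  simpa [hv] using real_inner_le_norm v (γ t - γ r)

/-- Cauchy's formula for the length of the curve. -/
lemma integral_breadth (hγ : IsCentered Γ γ ℓ) :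
    ∫ φ in (0 : ℝ)..2 * Real.pi, breadth Γ (unitVec φ) = 2 * length γ ℓ := by
  have h := hγ.integral_variation
  simp_rw [fun φ => hγ.variation_eq (norm_ne_zero_iff.1 (by rw [norm_unitVec]; exact one_ne_zero)
    : unitVec φ ≠ 0)] at h
  rw [intervalIntegral.integral_const_mul] at h
  linarith

/-- Half the variation is a parametric integral of a continuous function. Continuity is what turns
equality of integrals into pointwise equality. -/
lemma continuous_breadth (hγ : IsCentered Γ γ ℓ) :
    Continuous fun φ => breadth Γ (unitVec φ) := by
  have h := intervalIntegral.continuous_parametric_intervalIntegral_of_continuous'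
    (μ := MeasureTheory.volume) hγ.continuous_abs_inner_deriv 0 ℓ
  simp_rw [fun φ => hγ.variation_eq (norm_ne_zero_iff.1 (by rw [norm_unitVec]; exact one_ne_zero)
    : unitVec φ ≠ 0)] at h
  simpa using h.const_mul (1 / 2)

end IsCentered

end PlaneCurve

theorem mainTheorem1 (Γ : Set PlaneCurve.Plane) (γ : ℝ → PlaneCurve.Plane) (ℓ : ℝ)
    (hγ : PlaneCurve.IsClosedRegularC2Param Γ γ ℓ)
    (hconv : PlaneCurve.IsConvexCurve Γ)
    (hcenter : ∀ t : ℝ, PlaneCurve.curvature γ t ≠ 0 ∧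
      PlaneCurve.curvatureCenter γ t ∈ PlaneCurve.inside Γ) :
    Real.pi * PlaneCurve.minimax Γ ≤ PlaneCurve.length γ ℓ ∧
    (PlaneCurve.length γ ℓ = Real.pi * PlaneCurve.minimax Γ ↔
      PlaneCurve.HasConstantBreadth Γ) := by
  have hc : PlaneCurve.IsCentered Γ γ ℓ :=
    ⟨hγ, hconv.2, fun t => (hcenter t).1, fun t => (hcenter t).2⟩
  have hpi := Real.pi_pos
  have hcauchy := hc.integral_breadth
  have hle : ∀ φ, PlaneCurve.minimax Γ ≤ PlaneCurve.breadth Γ (PlaneCurve.unitVec φ) :=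
    fun φ => hc.minimax_le_breadth (PlaneCurve.norm_unitVec φ)
  have hconst : ∀ d : ℝ, ∫ _φ in (0 : ℝ)..2 * Real.pi, d = 2 * Real.pi * d := fun d => by
    rw [intervalIntegral.integral_const, sub_zero, smul_eq_mul]
  refine ⟨?_, fun heq => ⟨PlaneCurve.minimax Γ, fun u hu => ?_⟩, fun ⟨b, hb⟩ => ?_⟩
  · have := intervalIntegral.integral_mono (by positivity : (0 : ℝ) ≤ 2 * Real.pi)
      (_root_.intervalIntegrable_const (μ := MeasureTheory.volume) (c := PlaneCurve.minimax Γ))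
      (hc.continuous_breadth.intervalIntegrable _ _) hle
    rw [hconst, hcauchy] at this
    linarith
  · obtain ⟨φ, hφ, rfl⟩ := PlaneCurve.exists_eq_unitVec hu
    by_contra hne
    have := intervalIntegral.integral_lt_integral_of_continuousOn_of_le_of_exists_lt
      (by positivity : (0 : ℝ) < 2 * Real.pi) continuousOn_const
      hc.continuous_breadth.continuousOn (fun x _ => hle x)
      ⟨φ, hφ, lt_of_le_of_ne (hle φ) (Ne.symm hne)⟩
    rw [hconst, hcauchy] at this
    linarith
  · have hmin : PlaneCurve.minimax Γ = b := le_antisymm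
      (hb _ (PlaneCurve.norm_unitVec 0) ▸ hle 0) (hc.le_minimax_of_breadth_eq hb)
    simp_rw [fun φ => hb _ (PlaneCurve.norm_unitVec φ)] at hcauchy
    rw [hconst] at hcauchy
    rw [hmin]
    linarith
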